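/- Let $n\ge 1$ and order $[-\infty,+\infty]^n$ coordinatewise. For $i=1,\dots,n$ let $w_i\in[-\infty,+\infty]^n$ be the ideal point whose $i$-th coordinate is $+\infty$ and whose other coordinates are $-\infty$. For $A\subseteq\mathbb R^n$ put $A^*:=A\cup\{w_1,\dots,w_n\}\subseteq[-\infty,+\infty]^n$. A set $B\subseteq A^*$ is called $A^*$-neighborly if no $a\in A^*$ is strictly smaller than the supremum $\bigvee B$ (taken in $[-\infty,+\infty]^n$) in all coordinates. $\mathrm{Nb}(A^*)$ denotes the abstract simplicial complex of all finite $A^*$-neighborly subsets of $A^*$. For $b\in[-\infty,+\infty]^n$ and $J\subseteq\{1,\dots,n\}$, the $J$-th face of the down-set $\{x: x\le b\}$ is $\{x : x\le b,\ x_j=b_j \text{ for all } j\in J\}$; it is proper if it is not the whole down-set. $A^*$ is called generic if, for every $A^*$-neighborly $B\subseteq A^*$, every proper face of $\{x : x\le\bigvee B\}$ contains at most one element of $A^*$. **Theorem.** Let $A\subseteq\mathbb R^n$ be nonempty. Assume that for each $i=1,\dots,n$ the projection $\pi_i(A)\subseteq\mathbb R$ of $A$ to the $i$-th coordinate is closed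 and discrete, and that $A^*$ is a generic antichain in $[-\infty,+\infty]^n$. Let $|\mathrm{Nb}(A^*)|$ be the geometric realization of $\mathrm{Nb}(A^*)$ (with the weak topology), and let $|W|$ be the closed simplex spanned by $w_1,\dots,w_n$. Then $|\mathrm{Nb}(A^*)|\setminus|W|$, i.e. the set of points of $|\mathrm{Nb}(A^*)|$ having positive weight at some vertex in $A$, is homeomorphic to $\mathbb R^{n-1}$. -/

import Mathlib

noncomputable section

namespace Neighborly

/-- The embedding of `ℝⁿ` into `[-∞, +∞]ⁿ`. -/
def toExt {n : ℕ} (a : Fin n → ℝ) : Fin n → EReal := fun i => (a i : EReal)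

/-- The ideal point `w i`: its `i`-th coordinate is `+∞` and all its other coordinates are `-∞`. -/
def idealPoint {n : ℕ} (i : Fin n) : Fin n → EReal := fun j => if i = j then ⊤ else ⊥

/-- The augmentation `A* = A ∪ {w₁, …, wₙ}` of `A ⊆ ℝⁿ`, inside `[-∞, +∞]ⁿ`. -/
def augment {n : ℕ} (A : Set (Fin n → ℝ)) : Set (Fin n → EReal) :=
  toExt '' A ∪ Set.range idealPoint

/-- `B` is `A`-neighborly: no element of `A` is strictly below the supremum of `B` in all
coordinates. (In `[-∞, +∞]ⁿ` every set has a supremum.) -/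
def IsNeighborly {n : ℕ} (A B : Set (Fin n → EReal)) : Prop :=
  ∀ a ∈ A, ¬ ∀ i, a i < sSup B i

/-- The `J`-th face of the down-set of `b` (the bonnet with apex `b`). -/
def face {n : ℕ} (b : Fin n → EReal) (J : Set (Fin n)) : Set (Fin n → EReal) :=
  {x | x ≤ b ∧ ∀ j ∈ J, x j = b j}

/-- `A` is generic: whenever `B` is an `A`-neighborly subset of `A`, every proper face of the
bonnet over `B` contains at most one element of `A`. -/
def IsGeneric {n : ℕ} (A : Set (Fin n → EReal)) : Prop :=
  ∀ B ⊆ A, IsNeighborly A B → ∀ J : Set (Fin n),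
    face (sSup B) J ≠ Set.Iic (sSup B) → (A ∩ face (sSup B) J).Subsingleton

/-- The abstract simplicial complex `Nb(A)` of finite `A`-neighborly subsets of `A`
(Mathlib's convention does not count the empty set as a face). -/
def Nb {n : ℕ} (A : Set (Fin n → EReal)) : PreAbstractSimplicialComplex (Fin n → EReal) where
  faces := {B | B.Nonempty ∧ (B : Set (Fin n → EReal)) ⊆ A ∧ IsNeighborly A B}
  isRelLowerSet_faces := by
    rintro B ⟨hne, hBA, hB⟩
    refine ⟨hne, fun C hCB hC => ⟨hC, ?_, ?_⟩⟩
    · exact (Finset.coe_subset.2 hCB).trans hBA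
    · intro a ha hlt
      exact hB a ha fun i =>
        lt_of_lt_of_le (hlt i) ((sSup_le_sSup (Finset.coe_subset.2 hCB)) i)

/-- The points of the geometric realization `|K|` of an abstract simplicial complex `K`, given by
barycentric coordinates: finitely supported nonnegative weights on the vertices, of total mass one,
whose support is a simplex of `K`. -/
@[ext]
structure Realization {V : Type*} (K : PreAbstractSimplicialComplex V) where
  weight : V →₀ ℝ
  nonneg : ∀ v, 0 ≤ weight v
  sum_eq_one : (weight.sum fun _ r => r) = 1
  support_mem : weight.support ∈ K.faces

/-- The closed simplex of `|K|` spanned by a face `σ`, parametrized by the standard simplex on the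
vertices of `σ`. -/
def Realization.simplexMap {V : Type*} (K : PreAbstractSimplicialComplex V) (σ : Finset V)
    (hσ : σ ∈ K.faces) (x : stdSimplex ℝ σ) : Realization K where
  weight := (Finsupp.equivFunOnFinite.symm x.1).embDomain
    (Function.Embedding.subtype (· ∈ σ))
  nonneg := by
    intro v
    by_cases hv : v ∈ σ
    · have h := Finsupp.embDomain_apply_self (Function.Embedding.subtype (· ∈ σ))
        (Finsupp.equivFunOnFinite.symm x.1) ⟨v, hv⟩
      simp only [Function.Embedding.subtype_apply] at h
      rw [h]
      exact x.2.1 _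
    · rw [Finsupp.embDomain_of_notMem_range]
      simpa using hv
  sum_eq_one := by
    rw [Finsupp.sum_embDomain, Finsupp.sum_fintype _ _ (fun _ => rfl)]
    exact x.2.2
  support_mem := by
    have hne : ((Finsupp.equivFunOnFinite.symm x.1).embDomain
        (Function.Embedding.subtype (· ∈ σ))).support.Nonempty := by
      rw [Finsupp.support_embDomain, Finset.map_nonempty, Finsupp.support_nonempty_iff]
      intro h0
      have hx : x.1 = 0 := by
        funext v
        exact DFunLike.congr_fun h0 v
      have h1 := x.2.2
      rw [hx] at h1
      simp at h1
    refine (K.isRelLowerSet_faces hσ).2 ?_ hne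
    intro v hv
    rw [Finsupp.support_embDomain, Finset.mem_map] at hv
    obtain ⟨u, -, rfl⟩ := hv
    exact u.2

/-- The weak topology on `|K|`: a set is open if and only if its trace on every closed simplex is
open, each closed simplex carrying its Euclidean topology. -/
instance {V : Type*} (K : PreAbstractSimplicialComplex V) :
    TopologicalSpace (Realization K) :=
  ⨆ σ : K.faces, TopologicalSpace.coinduced (Realization.simplexMap K σ.1 σ.2) inferInstance

/-- The part of `|K|` lying in the closed simplex `|S|` spanned by a set `S` of vertices: the points
all of whose weight is on `S`. -/
def Realization.supportedOn {V : Type*} (K : PreAbstractSimplicialComplex V) (S : Set V) :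
    Set (Realization K) :=
  {p | (p.weight.support : Set V) ⊆ S}

end Neighborly

end

/-! Rescale each coordinate by increasing positive functions `φ i` that grow by a factor `n + 1`
between consecutive values on `A`. Send a point of `A` to its rescaled position, the ideal point
`w_i` to the direction `e_i`, and a point of the realization with positive mass on `A` to its
weighted position divided by that mass. This lands in `conv φ(A)` plus the positive orthant. The
steep growth makes the image the lower boundary of this set: every line parallel to `(1, …, 1)`
meets it exactly once. Projecting along that diagonal gives the homeomorphism with `ℝⁿ⁻¹`.

Injectivity is `IsScaling.weights_eq`, fed by the separation property `IsGeneric.exists_separating`.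
For surjectivity, slide a given point along the diagonal to the least height above the hull
(`exists_isBelow_min`); the support found there is neighborly (`exists_tight`). A continuous
bijection is not enough, so properness is proved from the finiteness of neighbors
(`finite_neighbors`, `exists_isCompact`). -/

namespace Neighborly

open Filter Topology

/-! ### Integer indices and finiteness from Dickson's lemma -/

/-- A closed discrete set of reals has an order-preserving enumeration by integers. -/
theorem exists_strictMonoOn_int {S : Set ℝ} (hc : IsClosed S) (hd : IsDiscrete S) :
    ∃ f : ℝ → ℤ, StrictMonoOn f S := by
  have hfin : ∀ a b : ℝ, (S ∩ Set.Ioc a b).Finite := by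
    intro a b
    have h1 : IsCompact (S ∩ Set.Icc a b) := isCompact_Icc.inter_left hc
    have h2 : (S ∩ Set.Icc a b).Finite := h1.finite (hd.mono Set.inter_subset_left)
    exact h2.subset (Set.inter_subset_inter_right _ Set.Ioc_subset_Icc_self)
  have hadd : ∀ a b c : ℝ, a ≤ b → b ≤ c →
      (S ∩ Set.Ioc a c).ncard = (S ∩ Set.Ioc a b).ncard + (S ∩ Set.Ioc b c).ncard := by
    intro a b c hab hbc
    rw [← Set.ncard_union_eq _ (hfin _ _) (hfin _ _), ← Set.inter_union_distrib_left,
      Set.Ioc_union_Ioc_eq_Ioc hab hbc]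
    rw [Set.disjoint_left]
    rintro x ⟨-, hx⟩ ⟨-, hx'⟩
    exact absurd hx.2 (not_le.2 hx'.1)
  have hempty : ∀ a b : ℝ, b ≤ a → (S ∩ Set.Ioc a b).ncard = 0 := by
    intro a b h
    rw [Set.Ioc_eq_empty (not_lt.2 h), Set.inter_empty, Set.ncard_empty]
  -- A signed count of the points of `S` between `0` and `s`. For `s < s'` in `S` the counts differ
  -- by the number of points in `(s, s']`, which contains `s'`.
  refine ⟨fun s => ((S ∩ Set.Ioc 0 s).ncard : ℤ) - (S ∩ Set.Ioc s 0).ncard, ?_⟩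
  intro s hs s' hs' hlt
  have hpos : 0 < (S ∩ Set.Ioc s s').ncard :=
    (Set.ncard_pos (hfin _ _)).2 ⟨s', hs', hlt, le_rfl⟩
  simp only
  rcases le_total 0 s with h | h
  · rw [hempty s 0 h, hempty s' 0 (h.trans hlt.le), hadd 0 s s' h hlt.le]
    omega
  · rcases le_total 0 s' with h' | h'
    · rw [hempty 0 s h, hempty s' 0 h']
      have := hadd s 0 s' h h'
      omega
    · rw [hempty 0 s h, hempty 0 s' h', hadd s s' 0 hlt.le h']
      omega

/-- Dickson's lemma. -/
theorem finite_of_separated {ι α : Type*} [Finite ι] {s : Set α} (g : α → ι → ℕ)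
    (h : ∀ a ∈ s, ∀ b ∈ s, a ≠ b → ∃ i, g a i < g b i) : s.Finite := by
  have hinj : Set.InjOn g s := by
    intro a ha b hb hab
    by_contra hne
    obtain ⟨i, hi⟩ := h a ha b hb hne
    rw [hab] at hi
    exact lt_irrefl _ hi
  refine Set.Finite.of_finite_image ?_ hinj
  have hanti : IsAntichain (· ≤ ·) (g '' s) := by
    rintro _ ⟨a, ha, rfl⟩ _ ⟨b, hb, rfl⟩ hne hle
    obtain ⟨i, hi⟩ := h b hb a ha (fun hab => hne (by rw [hab]))
    exact absurd (hle i) (not_le.2 hi)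
  exact hanti.finite_of_partiallyWellOrderedOn (Set.isPWO_of_wellQuasiOrderedLE _)

variable {n : ℕ}

theorem toExt_injective : Function.Injective (toExt (n := n)) := by
  intro a b h
  funext i
  exact EReal.coe_injective (congrFun h i)

theorem idealPoint_injective : Function.Injective (idealPoint (n := n)) := by
  intro i j h
  by_contra hne
  have := congrFun h i
  simp [idealPoint, Ne.symm hne] at this

theorem toExt_ne_idealPoint (a : Fin n → ℝ) (i : Fin n) : toExt a ≠ idealPoint i := by
  intro h
  have := congrFun h i
  simp [idealPoint, toExt] at this

theorem toExt_notMem_range_idealPoint (a : Fin n → ℝ) :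
    toExt a ∉ Set.range (idealPoint (n := n)) := by
  rintro ⟨i, hi⟩
  exact toExt_ne_idealPoint a i hi.symm

theorem toExt_mem_augment {A : Set (Fin n → ℝ)} {a : Fin n → ℝ} :
    toExt a ∈ augment A ↔ a ∈ A := by
  constructor
  · rintro (⟨b, hb, h⟩ | h)
    · rwa [← toExt_injective h]
    · exact absurd h (toExt_notMem_range_idealPoint a)
  · exact fun h => Or.inl ⟨a, h, rfl⟩

theorem IsNeighborly.mono {A B C : Set (Fin n → EReal)} (hB : IsNeighborly A B) (h : C ⊆ B) :
    IsNeighborly A C := fun a ha hlt =>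
  hB a ha fun i => (hlt i).trans_le (sSup_le_sSup h i)

/-! ### Separation and finiteness consequences of genericity -/

/-- In a generic augmentation, a neighborly set is strictly exceeded by every point of `A` in some
coordinate, up to that point itself. -/
theorem IsGeneric.exists_separating {A : Set (Fin n → ℝ)} (hgen : IsGeneric (augment A))
    {B : Set (Fin n → EReal)} (hBA : B ⊆ augment A) (hB : IsNeighborly (augment A) B)
    {d : Fin n → ℝ} (hd : d ∈ A) :
    ∃ i, ∀ c ∈ B, c ≠ toExt d → c i < d i := by
  have hle : ∀ c ∈ B, c ≤ sSup B := fun c hc => le_sSup hc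
  by_cases hex : ∃ i, sSup B i < d i
  · obtain ⟨i, hi⟩ := hex
    exact ⟨i, fun c hc _ => (hle c hc i).trans_lt hi⟩
  -- Now `d` lies below `⋁ B`, and neighborliness makes the two agree in some coordinate `i`. Any `c
  -- ∈ B` reaching `d i` shares with `d` the `i`-th face, which is proper because its `i`-th
  -- coordinate is real and can be lowered to `⊥`.
  push Not at hex
  have h1 := hB (toExt d) (toExt_mem_augment.2 hd)
  push Not at h1
  obtain ⟨i, hi⟩ := h1
  have heq : (d i : EReal) = sSup B i := le_antisymm (hex i) hi
  have hface : face (sSup B) {i} ≠ Set.Iic (sSup B) := by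
    intro h
    have hmem : Function.update (sSup B) i ⊥ ∈ face (sSup B) {i} := by
      rw [h]
      simp
    have := hmem.2 i rfl
    rw [Function.update_self, ← heq] at this
    exact EReal.bot_ne_coe _ this
  have hsub := hgen B hBA hB {i} hface
  refine ⟨i, fun c hc hne => lt_of_le_of_ne ((hle c hc i).trans heq.ge) fun h => hne ?_⟩
  refine hsub ⟨hBA hc, hle c hc, ?_⟩ ⟨toExt_mem_augment.2 hd, hex, ?_⟩
  · rintro j rfl
    rw [h, heq]
  · rintro j rfl
    exact heq

/-- A point of `A` has only finitely many neighbors. -/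
theorem IsGeneric.finite_neighbors {A : Set (Fin n → ℝ)} (hgen : IsGeneric (augment A))
    {idx : Fin n → ℝ → ℤ} (hidx : ∀ i, StrictMonoOn (idx i) ((fun a : Fin n → ℝ => a i) '' A))
    {a : Fin n → ℝ} (ha : a ∈ A) :
    {b | b ∈ A ∧ IsNeighborly (augment A) {toExt a, toExt b}}.Finite := by
  have key : ({b | b ∈ A ∧ IsNeighborly (augment A) {toExt a, toExt b}} \ {a}).Finite := by
    -- Separating `{a, b}` from another neighbor `c` gives a coordinate in which `c` exceeds both
    -- `a` and `b`. Hence truncating the index differences at zero still leaves a strict increase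
    -- from `b` to `c`.
    refine finite_of_separated (fun b i => (idx i (b i) - idx i (a i)).toNat) ?_
    rintro b ⟨⟨hb, hbn⟩, -⟩ c ⟨⟨hc, -⟩, hca⟩ hne
    have hsub : ({toExt a, toExt b} : Set (Fin n → EReal)) ⊆ augment A := by
      rintro _ (rfl | rfl)
      exacts [toExt_mem_augment.2 ha, toExt_mem_augment.2 hb]
    obtain ⟨i, hi⟩ := hgen.exists_separating hsub hbn hc
    have h1 := hi (toExt a) (by simp) (fun h => hca (toExt_injective h).symm)
    have h2 := hi (toExt b) (by simp) (fun h => hne (toExt_injective h))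
    have h1' : a i < c i := EReal.coe_lt_coe_iff.1 h1
    have h2' : b i < c i := EReal.coe_lt_coe_iff.1 h2
    have h3 := hidx i ⟨a, ha, rfl⟩ ⟨c, hc, rfl⟩ h1'
    have h4 := hidx i ⟨b, hb, rfl⟩ ⟨c, hc, rfl⟩ h2'
    exact ⟨i, by simp only at h3 h4 ⊢; omega⟩
  exact (key.union (Set.finite_singleton a)).subset fun b hb => by
    by_cases h : b = a <;> simp_all

/-- Only finitely many points of an antichain lie below given levels. -/
theorem finite_of_index_le {A : Set (Fin n → ℝ)} (hanti : IsAntichain (· ≤ ·) (augment A))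
    {idx : Fin n → ℝ → ℤ} (hidx : ∀ i, StrictMonoOn (idx i) ((fun a : Fin n → ℝ => a i) '' A))
    (K : ℤ) : {a | a ∈ A ∧ ∀ i, idx i (a i) ≤ K}.Finite := by
  refine finite_of_separated (fun a i => (K - idx i (a i)).toNat) ?_
  rintro a ⟨ha, haK⟩ b ⟨hb, hbK⟩ hne
  have h := hanti (toExt_mem_augment.2 ha) (toExt_mem_augment.2 hb)
    (fun h => hne (toExt_injective h))
  have h' : ∃ i, b i < a i := by
    by_contra hcon
    push Not at hcon
    exact h fun i => EReal.coe_le_coe_iff.2 (hcon i)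
  obtain ⟨i, hi⟩ := h'
  have h3 := hidx i ⟨b, hb, rfl⟩ ⟨a, ha, rfl⟩ hi
  have := haK i
  have := hbK i
  exact ⟨i, by simp only at h3 ⊢; omega⟩

/-! ### Scalings and uniqueness of representations -/

/-- The data used to place the points of `A` on a convex hypersurface: positive coordinate
functions growing by a factor of more than `n` along each projection of `A`, with finite sublevel
sets on `A`. -/
structure IsScaling (A : Set (Fin n → ℝ)) (φ : Fin n → ℝ → ℝ) : Prop where
  pos : ∀ i s, 0 < φ i s
  growth : ∀ a ∈ A, ∀ b ∈ A, ∀ i, a i < b i → (n + 1) * φ i (a i) ≤ φ i (b i)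
  finite_le : ∀ M : ℝ, {a | a ∈ A ∧ ∀ i, φ i (a i) ≤ M}.Finite

/-- A strict increase of an integer index multiplies the power by at least `n + 1`. A bound on the
powers bounds the indices, and then the antichain condition leaves finitely many points. -/
theorem isScaling_zpow {A : Set (Fin n → ℝ)} (hanti : IsAntichain (· ≤ ·) (augment A))
    {idx : Fin n → ℝ → ℤ} (hidx : ∀ i, StrictMonoOn (idx i) ((fun a : Fin n → ℝ => a i) '' A))
    (hn : 1 ≤ n) : IsScaling A (fun i s => ((n : ℝ) + 1) ^ idx i s) := by
  have hn0 : (1 : ℝ) ≤ n := by exact_mod_cast hn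
  have hn1 : (1 : ℝ) < n + 1 := by linarith
  refine ⟨fun i s => by positivity, ?_, ?_⟩
  · intro a ha b hb i hlt
    have h := hidx i ⟨a, ha, rfl⟩ ⟨b, hb, rfl⟩ hlt
    rw [← zpow_one_add₀ (by positivity)]
    exact zpow_le_zpow_right₀ hn1.le (by simp only at h; omega)
  · intro M
    obtain ⟨k, hk⟩ := pow_unbounded_of_one_lt M hn1
    refine (finite_of_index_le hanti hidx k).subset ?_
    rintro a ⟨ha, haM⟩
    refine ⟨ha, fun i => ?_⟩
    have h1 : ((n : ℝ) + 1) ^ idx i (a i) ≤ ((n : ℝ) + 1) ^ (k : ℤ) := by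
      rw [zpow_natCast]
      exact (haM i).trans hk.le
    exact (zpow_le_zpow_iff_right₀ hn1).1 h1

/-- A point of the lower hull of the scaled points has at most one representation whose support
is separated, even up to a shift along the diagonal. -/
theorem IsScaling.weights_eq {A : Set (Fin n → ℝ)} {φ : Fin n → ℝ → ℝ} (hφ : IsScaling A φ)
    {U : Finset (Fin n → ℝ)} (hU : U.Nonempty) (hUA : ∀ a ∈ U, a ∈ A)
    {l l' : (Fin n → ℝ) → ℝ} {μ μ' : Fin n → ℝ} {t : ℝ}
    (hl' : ∀ a, 0 ≤ l' a) (hμ' : ∀ i, 0 ≤ μ' i) (ht : 0 ≤ t)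
    (hsum : ∑ a ∈ U, l a = ∑ a ∈ U, l' a)
    (heq : ∀ i, ∑ a ∈ U, l a * φ i (a i) + μ i = ∑ a ∈ U, l' a * φ i (a i) + μ' i + t)
    (hsep : ∀ d ∈ U, ∃ i, μ i = 0 ∧ ∀ c ∈ U, 0 < l c → c ≠ d → c i < d i) :
    (∀ a ∈ U, l a = l' a) ∧ μ = μ' := by
  classical
  -- Cancel the common part of the two distributions: `α` is the excess of `l`, `β` that of `l'`.
  -- They have disjoint supports and equal totals.
  set α : (Fin n → ℝ) → ℝ := fun c => max (l c - l' c) 0 with hα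
  set β : (Fin n → ℝ) → ℝ := fun d => max (l' d - l d) 0 with hβ
  have hα0 : ∀ c, 0 ≤ α c := fun c => le_max_right _ _
  have hβ0 : ∀ c, 0 ≤ β c := fun c => le_max_right _ _
  have hαβ : ∀ c, α c + l' c = β c + l c := by
    intro c
    simp only [hα, hβ]
    rcases le_total (l c) (l' c) with h | h
    · rw [max_eq_right (by linarith), max_eq_left (by linarith)]; ring
    · rw [max_eq_left (by linarith), max_eq_right (by linarith)]; ring
  have hsumαβ : ∑ c ∈ U, α c = ∑ c ∈ U, β c := by
    have h := Finset.sum_congr (rfl : U = U) fun c _ => hαβ c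
    simp only [Finset.sum_add_distrib] at h
    linarith
  have hbal : ∀ i, ∑ d ∈ U, β d * φ i (d i) + μ' i + t = ∑ c ∈ U, α c * φ i (c i) + μ i := by
    intro i
    have h := Finset.sum_congr (rfl : U = U) fun c _ =>
      congrArg (fun x => x * φ i (c i)) (hαβ c)
    simp only [add_mul, Finset.sum_add_distrib] at h
    have := heq i
    linarith
  have : Nonempty (Fin n) := hU.elim fun d hd => (hsep d hd).elim fun i _ => ⟨i⟩
  choose! ι hι using hsep
  -- Group the `d` by separating coordinate. If `d₀` has the lowest `i`-th position among the `d` in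
  -- group `i` with `β d > 0`, every `c` with `α c > 0` lies below `d₀` by a factor `n + 1` in
  -- coordinate `i`, where also `μ i = 0`; the balance `hbal` then bounds the `β`-mass of the group.
  have hgroup : ∀ i, (n + 1) * ∑ d ∈ U with ι d = i, β d ≤ ∑ c ∈ U, α c := by
    intro i
    have hα1 : 0 ≤ ∑ c ∈ U, α c := Finset.sum_nonneg fun c _ => hα0 c
    rcases ({d ∈ U | ι d = i ∧ 0 < β d} : Finset _).eq_empty_or_nonempty with hT | hT
    · rw [Finset.sum_eq_zero, mul_zero]
      · exact hα1
      · intro d hd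
        rw [Finset.mem_filter] at hd
        by_contra hne
        have : d ∈ ({d ∈ U | ι d = i ∧ 0 < β d} : Finset _) :=
          Finset.mem_filter.2 ⟨hd.1, hd.2, lt_of_le_of_ne (hβ0 d) (Ne.symm hne)⟩
        rw [hT] at this
        exact absurd this (Finset.notMem_empty _)
    · obtain ⟨d₀, hd₀, hmin⟩ := Finset.exists_min_image _ (fun d => φ i (d i)) hT
      obtain ⟨hd₀U, hd₀i, hd₀β⟩ := Finset.mem_filter.1 hd₀
      have hμi : μ i = 0 := hd₀i ▸ (hι d₀ hd₀U).1
      have h1 : ∑ d ∈ U with ι d = i, β d * φ i (d₀ i) ≤ ∑ d ∈ U, β d * φ i (d i) := by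
        refine (Finset.sum_le_sum ?_).trans (Finset.sum_le_sum_of_subset_of_nonneg
          (Finset.filter_subset _ _) fun d _ _ => mul_nonneg (hβ0 d) (hφ.pos i _).le)
        intro d hd
        rw [Finset.mem_filter] at hd
        rcases (hβ0 d).eq_or_lt with h | h
        · rw [← h, zero_mul, zero_mul]
        · exact mul_le_mul_of_nonneg_left
            (hmin d (Finset.mem_filter.2 ⟨hd.1, hd.2, h⟩)) h.le
      have h2 : ∑ c ∈ U, α c * ((n + 1) * φ i (c i)) ≤ ∑ c ∈ U, α c * φ i (d₀ i) := by
        refine Finset.sum_le_sum fun c hc => ?_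
        rcases (hα0 c).eq_or_lt with h | h
        · rw [← h, zero_mul, zero_mul]
        · refine mul_le_mul_of_nonneg_left ?_ h.le
          have hlc : l' c < l c := by
            have := (lt_max_iff.1 h).resolve_right (lt_irrefl _)
            linarith
          have hcd : c ≠ d₀ := by
            rintro rfl
            have := (lt_max_iff.1 hd₀β).resolve_right (lt_irrefl _)
            linarith
          have hlt := (hι d₀ hd₀U).2 c hc ((hl' c).trans_lt hlc) hcd
          rw [hd₀i] at hlt
          exact hφ.growth c (hUA c hc) d₀ (hUA _ hd₀U) i hlt
      have h3 : ∑ c ∈ U, α c * ((n + 1) * φ i (c i)) = (n + 1) * ∑ c ∈ U, α c * φ i (c i) := by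
        rw [Finset.mul_sum]
        exact Finset.sum_congr rfl fun c _ => by ring
      rw [← Finset.sum_mul] at h1 h2
      rw [h3] at h2
      have hb := hbal i
      have hμ'i := hμ' i
      have hn : (0 : ℝ) < n + 1 := by positivity
      refine le_of_mul_le_mul_right ?_ (hφ.pos i (d₀ i))
      refine le_trans ?_ h2
      rw [mul_assoc]
      exact mul_le_mul_of_nonneg_left (by linarith) hn.le
  -- Summing over the `n` groups gives `(n + 1) ∑ β ≤ n ∑ α = n ∑ β`.
  have hβzero : ∑ d ∈ U, β d = 0 := by
    have h := Finset.sum_le_sum fun i (_ : i ∈ (Finset.univ : Finset (Fin n))) => hgroup i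
    rw [← Finset.mul_sum, Finset.sum_fiberwise, hsumαβ] at h
    simp only [Finset.sum_const, Finset.card_univ, Fintype.card_fin, nsmul_eq_mul] at h
    exact le_antisymm (by linarith) (Finset.sum_nonneg fun d _ => hβ0 d)
  have hll' : ∀ a ∈ U, l a = l' a := by
    intro a ha
    have h1 := (Finset.sum_eq_zero_iff_of_nonneg fun d _ => hβ0 d).1 hβzero a ha
    have h2 := (Finset.sum_eq_zero_iff_of_nonneg fun d _ => hα0 d).1 (hsumαβ.trans hβzero) a ha
    have := hαβ a
    linarith
  have hμt : ∀ i, μ i = μ' i + t := by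
    intro i
    have h := heq i
    rw [Finset.sum_congr rfl fun a ha => by rw [hll' a ha]] at h
    linarith
  refine ⟨hll', ?_⟩
  -- A separating coordinate has `μ = 0`, so there `μ' + t = 0`, and both nonnegative terms vanish.
  obtain ⟨d, hd⟩ := hU
  have h0 := (hι d hd).1
  have := hμt (ι d)
  have := hμ' (ι d)
  funext i
  have := hμt i
  linarith

/-! ### The least height above the hull -/

/-- `l` is a probability distribution on `A` whose mean scaled point is at most `t` above `y`. -/
structure IsBelow (A : Set (Fin n → ℝ)) (φ : Fin n → ℝ → ℝ) (y : Fin n → ℝ) (l : A → ℝ)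
    (t : ℝ) : Prop where
  nonneg : ∀ a, 0 ≤ l a
  hasSum : HasSum l 1
  summable : ∀ i, Summable fun a => l a * φ i (a.1 i)
  le : ∀ i, ∑' a, l a * φ i (a.1 i) ≤ y i + t

/-- The least height at which a point lies above the hull of the scaled points is attained. -/
theorem IsScaling.exists_isBelow_min {A : Set (Fin n → ℝ)} {φ : Fin n → ℝ → ℝ}
    (hφ : IsScaling A φ) (hne : A.Nonempty) (hn : 1 ≤ n) (y : Fin n → ℝ) :
    ∃ l t, IsBelow A φ y l t ∧ ∀ l' t', IsBelow A φ y l' t' → t ≤ t' := by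
  classical
  obtain ⟨a₀, ha₀⟩ := hne
  set t₀ : ℝ := ∑ i, |φ i (a₀ i) - y i| with ht₀
  set C : ℝ := ∑ i, (y i + t₀) with hC
  have hfin : ∀ R : ℝ, {a : A | ∀ i, φ i (a.1 i) ≤ R}.Finite := fun R =>
    ((hφ.finite_le R).preimage Subtype.val_injective.injOn).subset fun a ha => ⟨a.2, ha⟩
  -- All conditions are finite sums, hence closed under pointwise convergence. The last one is
  -- tightness: by Markov's inequality mass at most `C / R` lies outside a finite sublevel set, so
  -- no mass escapes in a limit. Positivity of `φ` gives the lower bound on `t`.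
  set K : Set ((A → ℝ) × ℝ) := {p | (∀ a, p.1 a ∈ Set.Icc (0 : ℝ) 1) ∧
    p.2 ∈ Set.Icc (-y ⟨0, hn⟩) t₀ ∧ (∀ s : Finset A, ∑ a ∈ s, p.1 a ≤ 1) ∧
    (∀ i, ∀ s : Finset A, ∑ a ∈ s, p.1 a * φ i (a.1 i) ≤ y i + p.2) ∧
    ∀ R : ℝ, 0 < R → 1 - C / R ≤ ∑ a ∈ (hfin R).toFinset, p.1 a} with hK
  have hKcompact : IsCompact K := by
    refine IsCompact.of_isClosed_subset
      ((isCompact_univ_pi fun _ : A => isCompact_Icc (a := (0 : ℝ)) (b := 1)).prod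
        (isCompact_Icc (a := -y ⟨0, hn⟩) (b := t₀))) ?_
      fun p hp => ⟨fun a _ => hp.1 a, hp.2.1⟩
    have hc : ∀ a : A, Continuous fun p : (A → ℝ) × ℝ => p.1 a := fun a => by fun_prop
    simp only [hK, Set.ofPred_and, Set.ofPred_forall]
    refine IsClosed.inter (isClosed_iInter fun a => isClosed_Icc.preimage (hc a)) ?_
    refine IsClosed.inter (isClosed_Icc.preimage continuous_snd) ?_
    refine IsClosed.inter (isClosed_iInter fun s => isClosed_le
      (continuous_finsetSum _ fun a _ => hc a) continuous_const) ?_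
    refine IsClosed.inter (isClosed_iInter fun i => isClosed_iInter fun s => isClosed_le
      (continuous_finsetSum _ fun a _ => (hc a).mul continuous_const)
      (continuous_const.add continuous_snd)) ?_
    exact isClosed_iInter fun R => isClosed_iInter fun _ => isClosed_le continuous_const
      (continuous_finsetSum _ fun a _ => hc a)
  have hKbelow : ∀ p ∈ K, IsBelow A φ y p.1 p.2 := by
    rintro ⟨l, t⟩ ⟨hl, ht, h1, h2, h3⟩
    simp only at hl ht h1 h2 h3
    have hs : Summable l := summable_of_sum_le (fun a => (hl a).1) h1
    have hs' : ∀ i, Summable fun a : A => l a * φ i (a.1 i) := fun i =>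
      summable_of_sum_le (fun a => mul_nonneg (hl a).1 (hφ.pos i _).le) (h2 i)
    refine ⟨fun a => (hl a).1, ?_, hs', fun i => (hs' i).tsum_le_of_sum_le (h2 i)⟩
    have hle : ∑' a, l a ≤ 1 := hs.tsum_le_of_sum_le h1
    have hge : 1 ≤ ∑' a, l a := by
      have hlim : Tendsto (fun R : ℝ => 1 - C / R) atTop (𝓝 (1 - 0)) :=
        tendsto_const_nhds.sub (tendsto_const_nhds.div_atTop tendsto_id)
      rw [sub_zero] at hlim
      refine le_of_tendsto hlim ?_
      filter_upwards [eventually_gt_atTop 0] with R hR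
      exact (h3 R hR).trans (hs.sum_le_tsum _ fun a _ => (hl a).1)
    rw [← le_antisymm hle hge]
    exact hs.hasSum
  have hbelowK : ∀ l t, IsBelow A φ y l t → t ≤ t₀ → (l, t) ∈ K := by
    intro l t h ht
    have hsum1 : ∀ s : Finset A, ∑ a ∈ s, l a ≤ 1 := fun s =>
      sum_le_hasSum s (fun a _ => h.nonneg a) h.hasSum
    have hsum2 : ∀ i, ∀ s : Finset A, ∑ a ∈ s, l a * φ i (a.1 i) ≤ y i + t := fun i s =>
      ((h.summable i).sum_le_tsum s fun a _ => mul_nonneg (h.nonneg a) (hφ.pos i _).le).trans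
        (h.le i)
    refine ⟨fun a => ⟨h.nonneg a, by simpa using hsum1 {a}⟩, ⟨?_, ht⟩, hsum1, hsum2, ?_⟩
    · have := hsum2 ⟨0, hn⟩ ∅
      simp only [Finset.sum_empty] at this
      simp only
      linarith
    · intro R hR
      rw [sub_le_iff_le_add]
      refine le_of_tendsto h.hasSum ?_
      filter_upwards [eventually_ge_atTop (hfin R).toFinset] with s hs
      rw [← Finset.sum_sdiff hs, add_comm]
      refine add_le_add_right ?_ _
      rw [le_div_iff₀ hR, Finset.sum_mul]
      have hstep : ∀ a ∈ s \ (hfin R).toFinset, l a * R ≤ ∑ i, l a * φ i (a.1 i) := by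
        intro a ha
        have ha' : ¬ ∀ i, φ i (a.1 i) ≤ R := by
          simpa using (Finset.mem_sdiff.1 ha).2
        push Not at ha'
        obtain ⟨i, hi⟩ := ha'
        exact (mul_le_mul_of_nonneg_left hi.le (h.nonneg a)).trans
          (Finset.single_le_sum (f := fun i => l a * φ i (a.1 i))
            (fun j _ => mul_nonneg (h.nonneg a) (hφ.pos j _).le) (Finset.mem_univ i))
      refine (Finset.sum_le_sum hstep).trans ?_
      rw [Finset.sum_comm]
      exact Finset.sum_le_sum fun i _ => (hsum2 i _).trans (by linarith)
  have hstart : IsBelow A φ y (Pi.single ⟨a₀, ha₀⟩ 1) t₀ := by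
    have hsup : ∀ i, ∀ b ≠ (⟨a₀, ha₀⟩ : A),
        (Pi.single (⟨a₀, ha₀⟩ : A) (1 : ℝ) : A → ℝ) b * φ i (b.1 i) = 0 := fun i b hb => by
      rw [Pi.single_eq_of_ne hb, zero_mul]
    refine ⟨fun a => ?_, hasSum_pi_single _ _, fun i => ?_, fun i => ?_⟩
    · exact (Pi.single_nonneg.2 zero_le_one : (0 : A → ℝ) ≤ _) a
    · exact (hasSum_single _ (hsup i)).summable
    · rw [tsum_eq_single _ (hsup i), Pi.single_eq_same, one_mul]
      have := Finset.single_le_sum (f := fun i => |φ i (a₀ i) - y i|)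
        (fun j _ => abs_nonneg _) (Finset.mem_univ i)
      have := le_abs_self (φ i (a₀ i) - y i)
      simp only at *
      linarith
  obtain ⟨⟨l, t⟩, hp, hmin⟩ := hKcompact.exists_isMinOn ⟨_, hbelowK _ _ hstart le_rfl⟩
    continuous_snd.continuousOn
  refine ⟨l, t, hKbelow _ hp, fun l' t' h => ?_⟩
  rcases le_total t' t₀ with ht | ht
  · exact hmin (hbelowK _ _ h ht)
  · exact (hp.2.1.2).trans ht

/-- At the least height the support is neighborly. -/
theorem IsScaling.exists_tight {A : Set (Fin n → ℝ)} {φ : Fin n → ℝ → ℝ}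
    (hφ : IsScaling A φ) (hn : 1 ≤ n) {y : Fin n → ℝ} {l : A → ℝ} {t : ℝ}
    (h : IsBelow A φ y l t) (hmin : ∀ l' t', IsBelow A φ y l' t' → t ≤ t') (c : A) :
    ∃ i, ∑' a, l a * φ i (a.1 i) = y i + t ∧ ∀ a, 0 < l a → a.1 i ≤ c.1 i := by
  classical
  by_contra hcon
  push Not at hcon
  have hn0 : (0 : ℝ) < n := by exact_mod_cast hn
  obtain ⟨a₀, ha₀⟩ : ∃ a, 0 < l a := by
    by_contra hz
    push Not at hz
    have : l = 0 := funext fun a => le_antisymm (hz a) (h.nonneg a)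
    have h1 := h.hasSum
    rw [this] at h1
    exact one_ne_zero (h1.unique hasSum_zero)
  -- Only the tight coordinates matter; in a slack one, `b i` is an arbitrary support point.
  have hb : ∀ i, ∃ b, 0 < l b ∧ (∑' a, l a * φ i (a.1 i) = y i + t → c.1 i < b.1 i) := by
    intro i
    by_cases hi : ∑' a, l a * φ i (a.1 i) = y i + t
    · obtain ⟨b, hb, hlt⟩ := hcon i hi
      exact ⟨b, hb, fun _ => hlt⟩
    · exact ⟨a₀, ha₀, fun h => absurd h hi⟩
  choose b hbpos hblt using hb
  -- `ε * D i` is the change in coordinate `i` when mass `ε` moves to `c`, taken equally from the `b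
  -- k`. In a tight coordinate `φ i` at `b i` alone exceeds `n` times its value at `c`, so `D i <
  -- 0`; slack coordinates tolerate a small `ε`. Afterwards every inequality is strict and `t` can
  -- be lowered.
  set D : Fin n → ℝ := fun i => φ i (c.1 i) - (n : ℝ)⁻¹ * ∑ k, φ i ((b k).1 i) with hD
  have hDneg : ∀ i, ∑' a, l a * φ i (a.1 i) = y i + t → D i < 0 := by
    intro i hi
    have h1 := hφ.growth c.1 c.2 (b i).1 (b i).2 i (hblt i hi)
    have h2 : φ i ((b i).1 i) ≤ ∑ k, φ i ((b k).1 i) :=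
      Finset.single_le_sum (f := fun k => φ i ((b k).1 i)) (fun k _ => (hφ.pos i _).le)
        (Finset.mem_univ i)
    have h3 := hφ.pos i (c.1 i)
    have h4 : n * φ i (c.1 i) < ∑ k, φ i ((b k).1 i) := by linarith
    have h5 : φ i (c.1 i) < (n : ℝ)⁻¹ * ∑ k, φ i ((b k).1 i) := by
      rw [inv_mul_eq_div, lt_div_iff₀ hn0]
      linarith
    simp only [hD]
    linarith
  have hev : ∀ᶠ ε in 𝓝[>] (0 : ℝ), 0 < ε ∧ (∀ k, ε ≤ l (b k)) ∧
      ∀ i, ∑' a, l a * φ i (a.1 i) + ε * D i < y i + t := by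
    refine eventually_mem_nhdsWithin.and (Filter.Eventually.and ?_ ?_)
    · rw [eventually_all]
      exact fun k => nhdsWithin_le_nhds (Iic_mem_nhds (hbpos k))
    · rw [eventually_all]
      intro i
      rcases (h.le i).eq_or_lt with hi | hi
      · filter_upwards [self_mem_nhdsWithin] with ε hε
        have := mul_neg_of_pos_of_neg (Set.mem_Ioi.1 hε) (hDneg i hi)
        linarith
      · have hlim : Tendsto (fun ε : ℝ => ∑' a, l a * φ i (a.1 i) + ε * D i) (𝓝 0)
            (𝓝 (∑' a, l a * φ i (a.1 i) + 0 * D i)) :=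
          Continuous.tendsto (by fun_prop) 0
        rw [zero_mul, add_zero] at hlim
        exact nhdsWithin_le_nhds (hlim.eventually_lt_const hi)
  obtain ⟨ε, hε, hεb, hεD⟩ := hev.exists
  have hevδ : ∀ᶠ δ in 𝓝[>] (0 : ℝ), 0 < δ ∧
      ∀ i, δ < y i + t - (∑' a, l a * φ i (a.1 i) + ε * D i) := by
    refine eventually_mem_nhdsWithin.and (eventually_all.2 fun i => ?_)
    exact nhdsWithin_le_nhds (Iio_mem_nhds (sub_pos.2 (hεD i)))
  obtain ⟨δ, hδ, hδi⟩ := hevδ.exists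
  set m : A → ℝ := fun a => ε * ((Pi.single c 1 : A → ℝ) a -
    (n : ℝ)⁻¹ * ∑ k, (Pi.single (b k) 1 : A → ℝ) a) with hm
  have hsingle : ∀ (d : A) (f : A → ℝ), HasSum (fun a => (Pi.single d 1 : A → ℝ) a * f a)
      (f d) := by
    intro d f
    have := hasSum_single (f := fun a => (Pi.single d 1 : A → ℝ) a * f a) d fun a ha => by
      rw [Pi.single_eq_of_ne ha, zero_mul]
    simpa using this
  have hmf : ∀ f : A → ℝ, HasSum (fun a => m a * f a)
      (ε * (f c - (n : ℝ)⁻¹ * ∑ k, f (b k))) := by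
    intro f
    have h1 := ((hsingle c f).sub ((hasSum_sum fun k (_ : k ∈ Finset.univ) =>
      hsingle (b k) f).mul_left (n : ℝ)⁻¹)).mul_left ε
    refine h1.congr_fun ?_
    intro a
    simp only [hm]
    rw [mul_assoc, sub_mul, mul_assoc, Finset.sum_mul]
  have hnew : IsBelow A φ y (fun a => l a + m a) (t - δ) := by
    have hφsum : ∀ i, HasSum (fun a => (l a + m a) * φ i (a.1 i))
        (∑' a, l a * φ i (a.1 i) + ε * D i) := by
      intro i
      simp only [add_mul]
      exact (h.summable i).hasSum.add (hmf fun a => φ i (a.1 i))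
    refine ⟨fun a => ?_, ?_, fun i => (hφsum i).summable, fun i => ?_⟩
    · have h0 : 0 ≤ (Pi.single c 1 : A → ℝ) a :=
        (Pi.single_nonneg.2 zero_le_one : (0 : A → ℝ) ≤ _) a
      -- The `b k` may coincide, so nonnegativity comes from averaging these `n` bounds.
      have h1 : ∀ k, ε * (Pi.single (b k) 1 : A → ℝ) a ≤ l a := by
        intro k
        by_cases hk : a = b k
        · subst hk
          simpa using hεb k
        · rw [Pi.single_eq_of_ne hk, mul_zero]
          exact h.nonneg a
      have h2 := Finset.sum_le_sum fun k (_ : k ∈ (Finset.univ : Finset (Fin n))) => h1 k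
      simp only [← Finset.mul_sum, Finset.sum_const, Finset.card_univ, Fintype.card_fin,
        nsmul_eq_mul] at h2
      have h3 : (n : ℝ)⁻¹ * (ε * ∑ k, (Pi.single (b k) 1 : A → ℝ) a) ≤ l a := by
        rw [inv_mul_eq_div, div_le_iff₀ hn0]
        linarith
      have h4 := mul_nonneg hε.le h0
      simp only [hm]
      nlinarith
    · have h1 := h.hasSum.add (hmf fun _ => 1)
      simp only [mul_one, Finset.sum_const, Finset.card_univ, Fintype.card_fin, nsmul_eq_mul,
        inv_mul_cancel₀ hn0.ne', sub_self, mul_zero, add_zero] at h1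
      exact h1
    · rw [(hφsum i).tsum_eq]
      have := hδi i
      linarith
  have := hmin _ _ hnew
  linarith

/-! ### Continuity on the geometric realization -/

section Realization

variable {V : Type*} {K : PreAbstractSimplicialComplex V}

theorem Realization.continuous_simplexMap (σ : Finset V) (hσ : σ ∈ K.faces) :
    Continuous (Realization.simplexMap K σ hσ) :=
  continuous_iff_coinduced_le.2
    (le_iSup (fun σ : K.faces => TopologicalSpace.coinduced
      (Realization.simplexMap K σ.1 σ.2) inferInstance) ⟨σ, hσ⟩)

/-- The weighted sum of a function on the vertices depends continuously on the point. -/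
theorem Realization.continuous_linearCombination (f : V → ℝ) :
    Continuous fun p : Realization K => Finsupp.linearCombination ℝ f p.weight := by
  refine continuous_iSup_dom.2 fun σ => continuous_coinduced_dom.2 ?_
  have h : (fun p : Realization K => Finsupp.linearCombination ℝ f p.weight) ∘
      Realization.simplexMap K σ.1 σ.2 = fun x => ∑ v : σ.1, x.1 v * f v := by
    funext x
    simp only [Function.comp_apply, Realization.simplexMap, Finsupp.linearCombination_embDomain]
    rw [Finsupp.linearCombination_apply, Finsupp.sum_fintype]
    · rfl
    · exact fun _ => zero_smul _ _
  rw [h]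
  exact continuous_finsetSum _ fun v _ =>
    ((continuous_apply v).comp continuous_subtype_val).mul continuous_const

theorem Realization.mem_range_simplexMap (p : Realization K) :
    p ∈ Set.range (Realization.simplexMap K p.weight.support p.support_mem) := by
  refine ⟨⟨fun v => p.weight v, fun v => p.nonneg v, ?_⟩, ?_⟩
  · rw [← p.sum_eq_one, Finsupp.sum, Finset.sum_coe_sort p.weight.support fun v => p.weight v]
  · ext v
    simp only [Realization.simplexMap]
    by_cases hv : v ∈ p.weight.support
    · have h := Finsupp.embDomain_apply_self
        (Function.Embedding.subtype (· ∈ p.weight.support))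
        (Finsupp.equivFunOnFinite.symm fun v : p.weight.support => p.weight v) ⟨v, hv⟩
      exact h
    · rw [Finsupp.embDomain_of_notMem_range, Finsupp.notMem_support_iff.1 hv]
      simpa using hv

theorem Realization.linearCombination_one (p : Realization K) :
    Finsupp.linearCombination ℝ (fun _ => (1 : ℝ)) p.weight = 1 := by
  rw [Finsupp.linearCombination_apply]
  simpa using p.sum_eq_one

end Realization

/-! ### Mass and barycenter coordinates -/

/-- The position of a vertex: a point of `ℝⁿ` is scaled coordinatewise, and an ideal point becomes
the corresponding coordinate direction. -/
noncomputable def position (φ : Fin n → ℝ → ℝ) (i : Fin n) (v : Fin n → EReal) : ℝ :=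
  if v i = ⊤ then 1 else if v i = ⊥ then 0 else φ i (v i).toReal

theorem position_toExt (φ : Fin n → ℝ → ℝ) (i : Fin n) (a : Fin n → ℝ) :
    position φ i (toExt a) = φ i (a i) := by
  simp [position, toExt]

theorem position_idealPoint (φ : Fin n → ℝ → ℝ) (i j : Fin n) :
    position φ i (idealPoint j) = if j = i then 1 else 0 := by
  by_cases h : j = i <;> simp [position, idealPoint, h]

open Classical in
/-- The mass of a vertex: one for points of `ℝⁿ` and zero for ideal points. -/
noncomputable def mass (v : Fin n → EReal) : ℝ := if v ∈ Set.range (idealPoint (n := n)) then 0 else 1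

theorem mass_toExt (a : Fin n → ℝ) : mass (toExt a) = 1 :=
  if_neg (toExt_notMem_range_idealPoint a)

theorem mass_idealPoint (i : Fin n) : mass (idealPoint i) = 0 := if_pos ⟨i, rfl⟩

/-- A weighted sum over the vertices of an augmented set, split into its two kinds of vertices. -/
theorem linearCombination_eq_sum {A : Set (Fin n → ℝ)} {w : (Fin n → EReal) →₀ ℝ}
    (hw : (w.support : Set (Fin n → EReal)) ⊆ augment A) {U : Finset (Fin n → ℝ)}
    (hU : ∀ a, toExt a ∈ w.support → a ∈ U) (f : (Fin n → EReal) → ℝ) :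
    Finsupp.linearCombination ℝ f w =
      ∑ a ∈ U, w (toExt a) * f (toExt a) + ∑ i, w (idealPoint i) * f (idealPoint i) := by
  classical
  have hsub : w.support ⊆ U.image toExt ∪ Finset.univ.image idealPoint := by
    intro v hv
    rw [Finset.mem_union, Finset.mem_image, Finset.mem_image]
    rcases hw hv with ⟨a, -, rfl⟩ | ⟨i, rfl⟩
    · exact Or.inl ⟨a, hU a hv, rfl⟩
    · exact Or.inr ⟨i, Finset.mem_univ i, rfl⟩
  rw [Finsupp.linearCombination_apply,
    Finsupp.sum_of_support_subset w hsub (fun v r => r • f v) fun _ _ => zero_smul _ _,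
    Finset.sum_union,
    Finset.sum_image toExt_injective.injOn, Finset.sum_image idealPoint_injective.injOn]
  · rfl
  · rw [Finset.disjoint_left]
    intro v hv hv'
    obtain ⟨a, -, rfl⟩ := Finset.mem_image.1 hv
    obtain ⟨i, -, h⟩ := Finset.mem_image.1 hv'
    exact toExt_ne_idealPoint a i h.symm

section Points

variable {A : Set (Fin n → ℝ)}

/-- The points of `ℝⁿ` carrying positive weight. -/
noncomputable def Realization.realSupport (p : Realization (Nb (augment A))) : Finset (Fin n → ℝ) :=
  p.weight.support.preimage toExt toExt_injective.injOn

theorem Realization.mem_realSupport {p : Realization (Nb (augment A))} {a : Fin n → ℝ} :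
    a ∈ p.realSupport ↔ toExt a ∈ p.weight.support := Finset.mem_preimage

theorem Realization.support_subset (p : Realization (Nb (augment A))) :
    (p.weight.support : Set (Fin n → EReal)) ⊆ augment A := p.support_mem.2.1

theorem Realization.mem_of_mem_realSupport {p : Realization (Nb (augment A))} {a : Fin n → ℝ}
    (h : a ∈ p.realSupport) : a ∈ A :=
  toExt_mem_augment.1 (p.support_subset (mem_realSupport.1 h))

/-- The total mass on points of `A`. -/
noncomputable def Realization.realMass (p : Realization (Nb (augment A))) : ℝ :=
  Finsupp.linearCombination ℝ mass p.weight

/-- The barycenter of the vertices of a point, normalized by its mass on `A`. -/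
noncomputable def Realization.barycenter (φ : Fin n → ℝ → ℝ) (p : Realization (Nb (augment A))) (i : Fin n) :
    ℝ :=
  p.realMass⁻¹ * Finsupp.linearCombination ℝ (position φ i) p.weight

theorem Realization.realMass_eq_sum (p : Realization (Nb (augment A))) {U : Finset (Fin n → ℝ)}
    (hU : p.realSupport ⊆ U) : p.realMass = ∑ a ∈ U, p.weight (toExt a) := by
  rw [realMass, linearCombination_eq_sum p.support_subset fun a ha =>
    hU (mem_realSupport.2 ha)]
  simp [mass_toExt, mass_idealPoint]

theorem Realization.barycenter_eq_sum (φ : Fin n → ℝ → ℝ) (p : Realization (Nb (augment A)))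
    {U : Finset (Fin n → ℝ)} (hU : p.realSupport ⊆ U) (i : Fin n) :
    p.barycenter φ i = ∑ a ∈ U, p.realMass⁻¹ * p.weight (toExt a) * φ i (a i) +
      p.realMass⁻¹ * p.weight (idealPoint i) := by
  rw [barycenter, linearCombination_eq_sum p.support_subset fun a ha =>
    hU (mem_realSupport.2 ha), mul_add, Finset.mul_sum]
  simp [position_toExt, position_idealPoint, mul_assoc]

theorem Realization.realMass_add_sum (p : Realization (Nb (augment A))) :
    p.realMass + ∑ i, p.weight (idealPoint i) = 1 := by
  rw [← p.linearCombination_one, linearCombination_eq_sum p.support_subset fun a ha =>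
    mem_realSupport.2 ha, p.realMass_eq_sum subset_rfl]
  simp

theorem Realization.realMass_pos_of_mem {p : Realization (Nb (augment A))} {a : Fin n → ℝ}
    (h : a ∈ p.realSupport) : 0 < p.realMass := by
  rw [p.realMass_eq_sum subset_rfl]
  refine Finset.sum_pos (fun b hb => ?_) ⟨a, h⟩
  exact lt_of_le_of_ne (p.nonneg _) (Ne.symm (Finsupp.mem_support_iff.1 (mem_realSupport.1 hb)))

theorem Realization.realMass_pos_iff {p : Realization (Nb (augment A))} :
    0 < p.realMass ↔ p ∈ Set.univ \ Realization.supportedOn (Nb (augment A))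
      (Set.range (idealPoint (n := n))) := by
  have h1 : p ∈ Set.univ \ Realization.supportedOn (Nb (augment A))
      (Set.range (idealPoint (n := n))) ↔
      ¬ (p.weight.support : Set (Fin n → EReal)) ⊆ Set.range idealPoint := by
    simp [Realization.supportedOn]
  rw [h1]
  constructor
  · intro h hsub
    rw [p.realMass_eq_sum subset_rfl, Finset.sum_eq_zero] at h
    · exact lt_irrefl _ h
    · intro a ha
      exact absurd (hsub (mem_realSupport.1 ha)) (toExt_notMem_range_idealPoint a)
  · intro h
    obtain ⟨v, hv, hv'⟩ := Set.not_subset.1 h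
    rcases p.support_subset hv with ⟨a, -, rfl⟩ | hi
    · exact realMass_pos_of_mem (mem_realSupport.2 hv)
    · exact absurd hi hv'

theorem Realization.normalized_sum {p : Realization (Nb (augment A))} (hp : 0 < p.realMass)
    {U : Finset (Fin n → ℝ)} (hU : p.realSupport ⊆ U) :
    ∑ a ∈ U, p.realMass⁻¹ * p.weight (toExt a) = 1 := by
  rw [← Finset.mul_sum, ← p.realMass_eq_sum hU, inv_mul_cancel₀ hp.ne']

/-! ### The barycenter map modulo the diagonal is bijective -/

/-- Injectivity modulo the diagonal. Separation is needed only for the support of the higher point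
`p`; the sign of `t` can be arranged by exchanging the two points. -/
theorem IsScaling.eq_of_barycenter_le {φ : Fin n → ℝ → ℝ} (hφ : IsScaling A φ)
    (hgen : IsGeneric (augment A)) {p q : Realization (Nb (augment A))}
    (hp : 0 < p.realMass) (hq : 0 < q.realMass) {t : ℝ} (ht : 0 ≤ t)
    (h : ∀ i, p.barycenter φ i = q.barycenter φ i + t) : p = q := by
  classical
  have hUA : ∀ a ∈ p.realSupport ∪ q.realSupport, a ∈ A := fun a ha =>
    (Finset.mem_union.1 ha).elim Realization.mem_of_mem_realSupport
      Realization.mem_of_mem_realSupport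
  have hUp : p.realSupport ⊆ p.realSupport ∪ q.realSupport := Finset.subset_union_left
  have hUq : q.realSupport ⊆ p.realSupport ∪ q.realSupport := Finset.subset_union_right
  have hne : (p.realSupport ∪ q.realSupport).Nonempty := by
    rw [Finset.nonempty_iff_ne_empty]
    intro h0
    have := Realization.normalized_sum hp hUp
    rw [h0, Finset.sum_empty] at this
    exact zero_ne_one this
  have key := hφ.weights_eq hne hUA
    (l := fun a => p.realMass⁻¹ * p.weight (toExt a))
    (l' := fun a => q.realMass⁻¹ * q.weight (toExt a))
    (μ := fun i => p.realMass⁻¹ * p.weight (idealPoint i))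
    (μ' := fun i => q.realMass⁻¹ * q.weight (idealPoint i))
    (fun a => mul_nonneg (inv_nonneg.2 hq.le) (q.nonneg _))
    (fun i => mul_nonneg (inv_nonneg.2 hq.le) (q.nonneg _)) ht
    ((Realization.normalized_sum hp hUp).trans (Realization.normalized_sum hq hUq).symm)
    (fun i => by rw [← p.barycenter_eq_sum φ hUp i, h i, q.barycenter_eq_sum φ hUq i]) ?_
  · have hw : p.realMass⁻¹ • p.weight = q.realMass⁻¹ • q.weight := by
      ext v
      simp only [Finsupp.smul_apply, smul_eq_mul]
      by_cases hv : v ∈ p.weight.support ∨ v ∈ q.weight.support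
      · have hvA : v ∈ augment A := hv.elim (fun h => p.support_subset h)
          fun h => q.support_subset h
        rcases hvA with ⟨a, -, rfl⟩ | ⟨i, rfl⟩
        · exact key.1 a (Finset.mem_union.2 (hv.imp Realization.mem_realSupport.2
            Realization.mem_realSupport.2))
        · exact congrFun key.2 i
      · push Not at hv
        rw [Finsupp.notMem_support_iff.1 hv.1, Finsupp.notMem_support_iff.1 hv.2, mul_zero,
          mul_zero]
    -- Both total weights are one, so equality of the normalized weights forces equal masses.
    have h1 := congrArg (Finsupp.linearCombination ℝ fun _ => (1 : ℝ)) hw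
    rw [map_smul, map_smul, p.linearCombination_one, q.linearCombination_one, smul_eq_mul,
      smul_eq_mul, mul_one, mul_one] at h1
    rw [h1] at hw
    exact Realization.ext (smul_right_injective _ (inv_ne_zero hq.ne') hw)
  · intro d hd
    obtain ⟨i, hi⟩ := hgen.exists_separating p.support_subset p.support_mem.2.2 (hUA d hd)
    refine ⟨i, ?_, fun c _ hc hcd => ?_⟩
    · rw [mul_eq_zero]
      refine Or.inr (by_contra fun h0 => ?_)
      have := hi (idealPoint i) (Finsupp.mem_support_iff.2 h0) (toExt_ne_idealPoint d i).symm
      simp [idealPoint] at this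
    · have hc' : p.weight (toExt c) ≠ 0 := fun h0 => by simp [h0] at hc
      exact EReal.coe_lt_coe_iff.1
        (hi (toExt c) (Finsupp.mem_support_iff.2 hc') fun h => hcd (toExt_injective h))

/-- Take a distribution of least height over `y` and let the slack in coordinate `i` become the
weight of `w_i`. Tightness makes the resulting support neighborly, and dividing by the total weight
gives a point of the realization. -/
theorem IsScaling.exists_barycenter_eq {φ : Fin n → ℝ → ℝ} (hφ : IsScaling A φ)
    (hne : A.Nonempty) (hn : 1 ≤ n)
    (hnbr : ∀ a ∈ A, {b | b ∈ A ∧ IsNeighborly (augment A) {toExt a, toExt b}}.Finite)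
    (y : Fin n → ℝ) :
    ∃ p : Realization (Nb (augment A)), 0 < p.realMass ∧ ∃ t, ∀ i, p.barycenter φ i = y i + t := by
  classical
  obtain ⟨l, t, hl, hmin⟩ := hφ.exists_isBelow_min hne hn y
  set μ : Fin n → ℝ := fun i => y i + t - ∑' a, l a * φ i (a.1 i) with hμ
  have hμ0 : ∀ i, 0 ≤ μ i := fun i => sub_nonneg.2 (hl.le i)
  set B : Set (Fin n → EReal) :=
    (fun a : A => toExt a.1) '' {a | 0 < l a} ∪ idealPoint '' {i | 0 < μ i} with hB
  have hBA : B ⊆ augment A := by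
    rintro _ (⟨a, -, rfl⟩ | ⟨i, -, rfl⟩)
    · exact toExt_mem_augment.2 a.2
    · exact Or.inr ⟨i, rfl⟩
  have hBn : IsNeighborly (augment A) B := by
    rintro _ (⟨c, hc, rfl⟩ | ⟨i, rfl⟩) hlt
    · obtain ⟨i, hi, hle⟩ := hφ.exists_tight hn hl hmin ⟨c, hc⟩
      refine absurd (hlt i) (not_lt.2 ?_)
      rw [sSup_apply]
      refine iSup_le ?_
      rintro ⟨_, ⟨a, ha, rfl⟩ | ⟨j, hj, rfl⟩⟩
      · exact EReal.coe_le_coe_iff.2 (hle a ha)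
      · have hji : j ≠ i := by
          rintro rfl
          have : 0 < μ j := hj
          simp only [hμ] at this
          linarith
        simp [idealPoint, hji]
    · have := hlt i
      simp [idealPoint] at this
  -- The minimizer might have infinite support a priori, but all its points are neighbors of any one
  -- of them.
  have hfin : {a | 0 < l a}.Finite := by
    rcases Set.eq_empty_or_nonempty {a | 0 < l a} with h0 | ⟨a, ha⟩
    · rw [h0]
      exact Set.finite_empty
    · refine ((hnbr a.1 a.2).preimage (f := fun b : A => b.1)
        Subtype.val_injective.injOn).subset fun b hb => ⟨b.2, hBn.mono ?_⟩
      rintro _ (rfl | rfl)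
      exacts [Or.inl ⟨a, ha, rfl⟩, Or.inl ⟨b, hb, rfl⟩]
  have hl0 : ∀ a ∉ hfin.toFinset, l a = 0 := fun a ha =>
    le_antisymm (by simpa using ha) (hl.nonneg a)
  set lf : A →₀ ℝ := Finsupp.onFinset hfin.toFinset l fun a ha => by
    by_contra h
    exact ha (hl0 a h) with hlf
  set w₀ : (Fin n → EReal) →₀ ℝ := lf.mapDomain (fun a => toExt a.1) +
    (Finsupp.equivFunOnFinite.symm μ).mapDomain idealPoint with hw₀
  have hinj : Function.Injective fun a : A => toExt a.1 :=
    toExt_injective.comp Subtype.val_injective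
  have hw₀nonneg : ∀ v, 0 ≤ w₀ v := by
    intro v
    rw [hw₀, Finsupp.add_apply]
    refine add_nonneg ?_ ?_
    · by_cases hv : v ∈ Set.range fun a : A => toExt a.1
      · obtain ⟨a, rfl⟩ := hv
        rw [Finsupp.mapDomain_apply hinj]
        exact hl.nonneg a
      · rw [Finsupp.mapDomain_of_notMem_range _ _ hv]
    · by_cases hv : v ∈ Set.range (idealPoint (n := n))
      · obtain ⟨i, rfl⟩ := hv
        rw [Finsupp.mapDomain_apply idealPoint_injective]
        exact hμ0 i
      · rw [Finsupp.mapDomain_of_notMem_range _ _ hv]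
  have hw₀B : (w₀.support : Set (Fin n → EReal)) ⊆ B := by
    intro v hv
    rcases Finset.mem_union.1 (Finsupp.support_add hv) with h | h
    · obtain ⟨a, ha, rfl⟩ := Finset.mem_image.1 (Finsupp.mapDomain_support h)
      exact Or.inl ⟨a, lt_of_le_of_ne (hl.nonneg a) (Ne.symm (Finsupp.mem_support_iff.1 ha)), rfl⟩
    · obtain ⟨i, hi, rfl⟩ := Finset.mem_image.1 (Finsupp.mapDomain_support h)
      exact Or.inr ⟨i, lt_of_le_of_ne (hμ0 i) (Ne.symm (Finsupp.mem_support_iff.1 hi)), rfl⟩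
  have hlin : ∀ f : (Fin n → EReal) → ℝ, Finsupp.linearCombination ℝ f w₀ =
      ∑' a, l a * f (toExt a.1) + ∑ i, μ i * f (idealPoint i) := by
    intro f
    rw [hw₀, map_add, Finsupp.linearCombination_mapDomain, Finsupp.linearCombination_mapDomain]
    congr 1
    · rw [tsum_eq_sum (s := hfin.toFinset) fun a ha => by rw [hl0 a ha, zero_mul],
        Finsupp.linearCombination_apply, Finsupp.sum_of_support_subset _
          Finsupp.support_onFinset_subset]
      · rfl
      · exact fun _ _ => zero_smul _ _
    · rw [Finsupp.linearCombination_apply, Finsupp.sum_fintype]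
      · rfl
      · exact fun _ => zero_smul _ _
  set M : ℝ := Finsupp.linearCombination ℝ (fun _ => (1 : ℝ)) w₀ with hM
  have hM' : M = 1 + ∑ i, μ i := by
    rw [hM, hlin]
    simp [hl.hasSum.tsum_eq]
  have hMpos : 0 < M := by
    have := Finset.sum_nonneg fun i (_ : i ∈ Finset.univ) => hμ0 i
    linarith
  have hsum : ((M⁻¹ • w₀).sum fun _ r => r) = 1 := by
    have h1 : Finsupp.linearCombination ℝ (fun _ => (1 : ℝ)) (M⁻¹ • w₀) = 1 := by
      rw [map_smul, ← hM, smul_eq_mul, inv_mul_cancel₀ hMpos.ne']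
    rw [Finsupp.linearCombination_apply] at h1
    simpa using h1
  have hsupp : ((M⁻¹ • w₀).support : Set (Fin n → EReal)) ⊆ B :=
    (Finset.coe_subset.2 Finsupp.support_smul).trans hw₀B
  refine ⟨⟨M⁻¹ • w₀, fun v => ?_, hsum, ?_, hsupp.trans hBA, hBn.mono hsupp⟩, ?_⟩
  · exact mul_nonneg (inv_nonneg.2 hMpos.le) (hw₀nonneg v)
  · rw [Finsupp.support_nonempty_iff]
    intro h0
    rw [h0, Finsupp.sum_zero_index] at hsum
    exact zero_ne_one hsum
  · have hmass : Finsupp.linearCombination ℝ mass (M⁻¹ • w₀) = M⁻¹ := by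
      rw [map_smul, hlin]
      simp [mass_toExt, mass_idealPoint, hl.hasSum.tsum_eq]
    refine ⟨?_, t, fun i => ?_⟩
    · rw [Realization.realMass, hmass]
      exact inv_pos.2 hMpos
    · rw [Realization.barycenter, Realization.realMass, hmass, map_smul, hlin, smul_eq_mul,
        inv_inv, mul_inv_cancel_left₀ hMpos.ne']
      simp [position_toExt, position_idealPoint, hμ]

end Points

/-! ### Bounds and compactness -/

section Points

variable {A : Set (Fin n → ℝ)}

theorem Realization.continuous_realMass :
    Continuous (Realization.realMass (A := A)) :=
  Realization.continuous_linearCombination mass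

/-- Some coordinate of the barycenter is bounded by that of a given point of `A`. -/
theorem IsScaling.exists_barycenter_le {φ : Fin n → ℝ → ℝ} (hφ : IsScaling A φ)
    {p : Realization (Nb (augment A))} (hp : 0 < p.realMass) {a : Fin n → ℝ} (ha : a ∈ A) :
    ∃ i, p.barycenter φ i ≤ φ i (a i) := by
  -- Neighborliness gives a coordinate in which no vertex of `p` exceeds `a`; this excludes `w_i`.
  have h := p.support_mem.2.2 (toExt a) (toExt_mem_augment.2 ha)
  push Not at h
  obtain ⟨i, hi⟩ := h
  have hle : ∀ v ∈ p.weight.support, v i ≤ a i := fun v hv =>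
    (le_sSup (a := v) (s := (p.weight.support : Set (Fin n → EReal))) hv i).trans hi
  refine ⟨i, ?_⟩
  have hideal : p.weight (idealPoint i) = 0 := by
    by_contra h0
    have := hle _ (Finsupp.mem_support_iff.2 h0)
    simp [idealPoint] at this
  rw [p.barycenter_eq_sum φ subset_rfl, hideal, mul_zero, add_zero]
  calc ∑ c ∈ p.realSupport, p.realMass⁻¹ * p.weight (toExt c) * φ i (c i)
      ≤ ∑ c ∈ p.realSupport, p.realMass⁻¹ * p.weight (toExt c) * φ i (a i) := by
        refine Finset.sum_le_sum fun c hc => mul_le_mul_of_nonneg_left ?_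
          (mul_nonneg (inv_nonneg.2 hp.le) (p.nonneg _))
        have hci : c i ≤ a i :=
          EReal.coe_le_coe_iff.1 (hle _ (Realization.mem_realSupport.1 hc))
        rcases hci.eq_or_lt with h | h
        · rw [h]
        · have h1 := hφ.growth c (Realization.mem_of_mem_realSupport hc) a ha i h
          have h2 := mul_nonneg (Nat.cast_nonneg (α := ℝ) n) (hφ.pos i (c i)).le
          linarith
    _ = φ i (a i) := by
        rw [← Finset.sum_mul, Realization.normalized_sum hp subset_rfl, one_mul]

/-- A bound on the barycenter bounds the mass from below and forces a vertex with bounded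
position. -/
theorem IsScaling.bounds_of_barycenter_le {φ : Fin n → ℝ → ℝ} (hφ : IsScaling A φ)
    {p : Realization (Nb (augment A))} (hp : 0 < p.realMass) {M : ℝ}
    (hM : ∀ i, p.barycenter φ i ≤ M) :
    1 ≤ p.realMass * (1 + n * M) ∧ ∃ a ∈ p.realSupport, ∀ i, φ i (a i) ≤ n * M := by
  have hb := fun i => p.barycenter_eq_sum φ subset_rfl i
  have hl : ∀ a, 0 ≤ p.realMass⁻¹ * p.weight (toExt a) := fun a =>
    mul_nonneg (inv_nonneg.2 hp.le) (p.nonneg _)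
  have hsumM : ∑ i, p.barycenter φ i ≤ n * M := by
    refine (Finset.sum_le_sum fun i _ => hM i).trans ?_
    simp
  constructor
  -- Summing over `i` bounds the ideal weight `1 - p.realMass` by `p.realMass * (n * M)`.
  · have h1 : ∀ i, p.weight (idealPoint i) ≤ p.realMass * p.barycenter φ i := by
      intro i
      rw [hb i, mul_add, mul_inv_cancel_left₀ hp.ne']
      have := Finset.sum_nonneg fun a (_ : a ∈ p.realSupport) =>
        mul_nonneg (hl a) (hφ.pos i (a i)).le
      have := mul_nonneg hp.le this
      linarith
    have h2 := Finset.sum_le_sum fun i (_ : i ∈ (Finset.univ : Finset (Fin n))) => h1 i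
    rw [← Finset.mul_sum] at h2
    have h3 := mul_le_mul_of_nonneg_left hsumM hp.le
    have h4 := p.realMass_add_sum
    linarith
  · by_contra hcon
    push Not at hcon
    -- Otherwise the average over `A` of the coordinate sum exceeds `n * M`, the bound on the sum of
    -- the barycenter coordinates.
    have hlow : ∀ a ∈ p.realSupport, n * M < ∑ i, φ i (a i) := by
      intro a ha
      obtain ⟨i, hi⟩ := hcon a ha
      exact hi.trans_le (Finset.single_le_sum (f := fun i => φ i (a i))
        (fun j _ => (hφ.pos j _).le) (Finset.mem_univ i))
    have h1 : ∑ a ∈ p.realSupport, p.realMass⁻¹ * p.weight (toExt a) * (n * M) <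
        ∑ a ∈ p.realSupport, p.realMass⁻¹ * p.weight (toExt a) * ∑ i, φ i (a i) := by
      have hne : p.realSupport.Nonempty := by
        rw [Finset.nonempty_iff_ne_empty]
        intro h0
        have := Realization.normalized_sum hp subset_rfl
        rw [h0, Finset.sum_empty] at this
        exact zero_ne_one this
      refine Finset.sum_lt_sum_of_nonempty hne fun a ha => mul_lt_mul_of_pos_left (hlow a ha) ?_
      exact mul_pos (inv_pos.2 hp) (lt_of_le_of_ne (p.nonneg _)
        (Ne.symm (Finsupp.mem_support_iff.1 (Realization.mem_realSupport.1 ha))))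
    rw [← Finset.sum_mul, Realization.normalized_sum hp subset_rfl, one_mul] at h1
    simp only [Finset.mul_sum] at h1
    rw [Finset.sum_comm] at h1
    refine absurd (h1.trans_le (le_trans (Finset.sum_le_sum fun i _ => ?_) hsumM)) (lt_irrefl _)
    rw [hb i]
    exact le_add_of_nonneg_right (mul_nonneg (inv_nonneg.2 hp.le) (p.nonneg _))

/-- The points with bounded barycenter lie in a compact set of points of positive mass. -/
theorem IsScaling.exists_isCompact {φ : Fin n → ℝ → ℝ} (hφ : IsScaling A φ)
    (hnbr : ∀ a ∈ A, {b | b ∈ A ∧ IsNeighborly (augment A) {toExt a, toExt b}}.Finite)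
    {M : ℝ} (hM0 : 0 ≤ M) :
    ∃ Q : Set (Realization (Nb (augment A))), IsCompact Q ∧ (∀ p ∈ Q, 0 < p.realMass) ∧
      ∀ p : Realization (Nb (augment A)), 0 < p.realMass → (∀ i, p.barycenter φ i ≤ M) →
        p ∈ Q := by
  classical
  have hpos : 0 < 1 + n * M := by positivity
  -- A bounded barycenter forces a vertex from a finite sublevel set, and the other real vertices
  -- are its neighbors. Only finitely many simplices occur, each cut down to the compact part where
  -- the mass is at least `(1 + n * M)⁻¹`.
  set T : Set (Fin n → EReal) := toExt '' (⋃ a ∈ {a | a ∈ A ∧ ∀ i, φ i (a i) ≤ n * M},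
    {b | b ∈ A ∧ IsNeighborly (augment A) {toExt a, toExt b}}) ∪ Set.range idealPoint with hT
  have hTfin : T.Finite := (((hφ.finite_le _).biUnion fun a ha => hnbr a ha.1).image _).union
    (Set.finite_range _)
  set P : Set (Nb (augment A)).faces := {σ | (σ.1 : Set (Fin n → EReal)) ⊆ T} with hP
  have hPfin : P.Finite := by
    refine (hTfin.toFinset.powerset.finite_toSet.preimage
      (f := fun σ : (Nb (augment A)).faces => σ.1) Subtype.val_injective.injOn).subset ?_
    exact fun σ hσ => Finset.mem_powerset.2 fun v hv => hTfin.mem_toFinset.2 (hσ hv)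
  refine ⟨⋃ σ ∈ P, Realization.simplexMap _ σ.1 σ.2 ''
    {x | (1 + n * M)⁻¹ ≤ (Realization.simplexMap _ σ.1 σ.2 x).realMass}, ?_, ?_, ?_⟩
  · refine hPfin.isCompact_biUnion fun σ _ => IsCompact.image ?_
      (Realization.continuous_simplexMap σ.1 σ.2)
    exact (isClosed_le continuous_const (Realization.continuous_realMass.comp
      (Realization.continuous_simplexMap σ.1 σ.2))).isCompact
  · intro p hp
    simp only [Set.mem_iUnion] at hp
    obtain ⟨σ, -, x, hx, rfl⟩ := hp
    exact (inv_pos.2 hpos).trans_le hx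
  · intro p hp hle
    obtain ⟨h1, a, ha, haM⟩ := hφ.bounds_of_barycenter_le hp hle
    obtain ⟨x, hx⟩ := p.mem_range_simplexMap
    simp only [Set.mem_iUnion]
    refine ⟨⟨p.weight.support, p.support_mem⟩, ?_, x, ?_, hx⟩
    · intro v hv
      rcases p.support_subset hv with ⟨b, hb, rfl⟩ | hi
      · refine Or.inl ⟨b, Set.mem_biUnion
          ⟨Realization.mem_of_mem_realSupport ha, haM⟩ ⟨hb, p.support_mem.2.2.mono ?_⟩, rfl⟩
        rintro _ (rfl | rfl)
        exacts [Realization.mem_realSupport.1 ha, hv]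
      · exact Or.inr hi
    · simp only [Set.mem_ofPred_eq]
      rw [hx, inv_eq_one_div, div_le_iff₀ hpos]
      exact h1

end Points

/-! ### The homeomorphism -/

/-- The barycenter map modulo the diagonal is a homeomorphism. -/
theorem IsScaling.nonempty_homeomorph {m : ℕ} {A : Set (Fin (m + 1) → ℝ)}
    {φ : Fin (m + 1) → ℝ → ℝ} (hφ : IsScaling A φ) (hne : A.Nonempty)
    (hgen : IsGeneric (augment A))
    (hnbr : ∀ a ∈ A, {b | b ∈ A ∧ IsNeighborly (augment A) {toExt a, toExt b}}.Finite) :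
    Nonempty (↥{p : Realization (Nb (augment A)) | 0 < p.realMass} ≃ₜ (Fin m → ℝ)) := by
  set F : {p : Realization (Nb (augment A)) | 0 < p.realMass} → Fin m → ℝ :=
    fun p j => p.1.barycenter φ j.succ - p.1.barycenter φ 0 with hF
  have hcontb : ∀ i, Continuous fun p : {p : Realization (Nb (augment A)) | 0 < p.realMass} =>
      p.1.barycenter φ i := by
    intro i
    exact ((Realization.continuous_realMass.comp continuous_subtype_val).inv₀
      fun p => p.2.ne').mul
      ((Realization.continuous_linearCombination _).comp continuous_subtype_val)
  have hcont : Continuous F := continuous_pi fun j => (hcontb _).sub (hcontb _)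
  have hinj : Function.Injective F := by
    intro p q hpq
    have h : ∀ i, p.1.barycenter φ i =
        q.1.barycenter φ i + (p.1.barycenter φ 0 - q.1.barycenter φ 0) := by
      intro i
      refine Fin.cases (by ring) (fun j => ?_) i
      have := congrFun hpq j
      simp only [hF] at this
      linarith
    rcases le_total 0 (p.1.barycenter φ 0 - q.1.barycenter φ 0) with h0 | h0
    · exact Subtype.ext (hφ.eq_of_barycenter_le hgen p.2 q.2 h0 h)
    · refine Subtype.ext (hφ.eq_of_barycenter_le hgen q.2 p.2 (neg_nonneg.2 h0) fun i => ?_).symm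
      have := h i
      linarith
  have hsurj : Function.Surjective F := by
    intro y
    obtain ⟨p, hp, t, ht⟩ := hφ.exists_barycenter_eq hne (Nat.le_add_left 1 m) hnbr
      (Fin.cons 0 y)
    refine ⟨⟨p, hp⟩, funext fun j => ?_⟩
    simp only [hF, ht, Fin.cons_succ, Fin.cons_zero]
    ring
  have hproper : IsProperMap F := by
    refine isProperMap_iff_isCompact_preimage.2 ⟨hcont, fun K hK => ?_⟩
    obtain ⟨R, hR⟩ := hK.isBounded.exists_norm_le
    obtain ⟨a, ha⟩ := hne
    have hR0 : (0 : ℝ) ≤ max R 0 := le_max_right _ _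
    have hS0 : 0 ≤ ∑ i, φ i (a i) := Finset.sum_nonneg fun i _ => (hφ.pos i _).le
    -- Some barycenter coordinate is at most that of `a`, and any two coordinates differ by at most
    -- `2 * max R 0`, passing through coordinate `0`. The maximum covers an empty `K`, for which `R`
    -- may be negative.
    obtain ⟨Q, hQ, hQpos, hQmem⟩ := hφ.exists_isCompact hnbr
      (M := ∑ i, φ i (a i) + 2 * max R 0) (by positivity)
    have hQ' : IsCompact (Subtype.val ⁻¹' Q :
        Set {p : Realization (Nb (augment A)) | 0 < p.realMass}) := by
      rw [Subtype.isCompact_iff, Subtype.image_preimage_coe]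
      have hinter : {p : Realization (Nb (augment A)) | 0 < p.realMass} ∩ Q = Q :=
        Set.inter_eq_right.2 hQpos
      rwa [hinter]
    refine hQ'.of_isClosed_subset (hK.isClosed.preimage hcont) fun p hp => hQmem p.1 p.2 ?_
    have hbound : ∀ i, |p.1.barycenter φ i - p.1.barycenter φ 0| ≤ max R 0 := by
      intro i
      refine Fin.cases (by simp) (fun j => ?_) i
      exact ((norm_le_pi_norm (F p) j).trans (hR _ hp)).trans (le_max_left _ _)
    obtain ⟨i₀, hi₀⟩ := hφ.exists_barycenter_le p.2 ha
    have h1 : φ i₀ (a i₀) ≤ ∑ i, φ i (a i) :=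
      Finset.single_le_sum (f := fun i => φ i (a i)) (fun i _ => (hφ.pos i _).le)
        (Finset.mem_univ i₀)
    intro i
    have h2 := (abs_le.1 (hbound i)).2
    have h3 := (abs_le.1 (hbound i₀)).1
    linarith
  exact ⟨(isHomeomorph_iff_continuous_isClosedMap_bijective.2
    ⟨hcont, hproper.isClosedMap, hinj, hsurj⟩).homeomorph⟩

end Neighborly

theorem mainTheorem6 (n : ℕ) (hn : 1 ≤ n) (A : Set (Fin n → ℝ)) (hne : A.Nonempty)
    (hclosed : ∀ i : Fin n, IsClosed ((fun a : Fin n → ℝ => a i) '' A))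
    (hdiscrete : ∀ i : Fin n, IsDiscrete ((fun a : Fin n → ℝ => a i) '' A))
    (hanti : IsAntichain (· ≤ ·) (Neighborly.augment A))
    (hgen : Neighborly.IsGeneric (Neighborly.augment A)) :
    Nonempty
      (↥((Set.univ : Set (Neighborly.Realization (Neighborly.Nb (Neighborly.augment A)))) \
          Neighborly.Realization.supportedOn (Neighborly.Nb (Neighborly.augment A))
            (Set.range (Neighborly.idealPoint (n := n)))) ≃ₜ
        EuclideanSpace ℝ (Fin (n - 1))) := by
  choose idx hidx using fun i => Neighborly.exists_strictMonoOn_int (hclosed i) (hdiscrete i)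
  have hφ := Neighborly.isScaling_zpow hanti hidx hn
  obtain ⟨m, rfl⟩ := Nat.exists_eq_add_of_le' hn
  obtain ⟨e⟩ := hφ.nonempty_homeomorph hne hgen fun a ha => hgen.finite_neighbors hidx ha
  have hset : Set.univ \ Neighborly.Realization.supportedOn
      (Neighborly.Nb (Neighborly.augment A)) (Set.range Neighborly.idealPoint) =
      {p | 0 < p.realMass} := Set.ext fun p => Neighborly.Realization.realMass_pos_iff.symm
  rw [hset]
  exact ⟨e.trans (PiLp.homeomorph 2 fun _ : Fin m => ℝ).symm⟩
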